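/- **Stability of gated GRNNs.** All vector norms are Euclidean and all matrix norms are the induced operator norms. *Graphs.* Let $I\subseteq\mathbb R$ be an interval (possibly $I=\mathbb R$). A graph shift operator (GSO) is a symmetric matrix in $\mathbb R^{N\times N}$ whose eigenvalues lie in $I$. For GSOs $S,\tilde S$ let $$\mathcal E(S,\tilde S)=\{E\in\mathbb R^{N\times N}: P^{\mathsf T}\tilde SP=S+(ES+SE)\text{ for some permutation matrix }P\},\qquad d(S,\tilde S)=\inf_{E\in\mathcal E(S,\tilde S)}\|E\|.$$ *Architecture.* For a filter $h(\lambda)=\sum_k h_k\lambda^k$ (finitely many taps) let $h(S)=\sum_k h_kS^k$. Let $a,b,c,\hat a,\hat b,\check a,\check b$ be filters and $\sigma,\rho,\hat\sigma,\check\sigma:\mathbb R\to\mathbb R$ activation functions, applied entrywise. On a GSO $S$ and an input sequence $x_1,x_2,\dots\in\mathbb R^N$, the gated GRNN with one input and one state feature is $z_0=\hat z_0=\check z_0=0$ and, for $t\ge1$, $$\hat z_t=\hat\sigma(\hat a(S)x_t+\hat b(S)\hat z_{t-1}),\qquad \check z_t=\check\sigma(\check a(S)x_t+\check b(S)\check z_{t-1}),$$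 $$z_t=\sigma\big(\hat{\mathcal Q}_{\hat\theta_t}\,a(S)x_t+\check{\mathcal Q}_{\check\theta_t}\,b(S)z_{t-1}\big),\qquad \hat\theta_t=\hat\Phi_S(\hat z_t),\quad \check\theta_t=\check\Phi_S(\check z_t),$$ with output $y_t=\rho(c(S)z_t)$, $t\ge 0$. Here $\hat{\mathcal Q}_\theta,\check{\mathcal Q}_\theta$ are families of linear operators on $\mathbb R^N$ (input and forget gate), whose parameters $\theta$ range over given subsets of normed spaces, and $\hat\Phi_S,\check\Phi_S$ are maps from $\mathbb R^N$ into these subsets. Examples are time gating ($\mathcal Q_\theta=\theta\,\mathrm{Id}$, $\theta\in[0,1]$), node gating ($\mathcal Q_\theta=\mathrm{diag}(\theta)$, $\theta\in[0,1]^N$), and any gate (in particular one that modifies edges) given as a linear operator acting on the filtered signals, with the operator itself as parameter. *Assumptions.* Let $Q,\phi_1,\phi_2\ge0$. 1. Each filter $h$ satisfies $|h(\lambda)|\le1$ on $I$ and is integral Lipschitz on $I$ with a constant $C_h\ge0$: $|h(\lambda_2)-h(\lambda_1)|\,|\lambda_1+\lambda_2|/2\le C_h|\lambda_2-\lambda_1|$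 for $\lambda_1,\lambda_2\in I$. Let $C=\max\{C_a,C_b,C_{\hat a},C_{\hat b},C_{\check a},C_{\check b},C_c\}$. 2. Each activation function $f$ satisfies $f(0)=0$ and $|f(u)-f(v)|\le|u-v|$. 3. The gates satisfy $\|\mathcal Q_\theta\|\le1$ and $\|\mathcal Q_{\theta_1}-\mathcal Q_{\theta_2}\|\le Q\|\theta_1-\theta_2\|$ for all admissible parameters. 4. $\|\Phi_{S_1}(z)-\Phi_{S_1}(z')\|\le\phi_1\|z-z'\|$ for all GSOs $S_1$ and all $z,z'$, for $\Phi=\hat\Phi,\check\Phi$. 5. One of the following holds for both $\Phi=\hat\Phi$ and $\Phi=\check\Phi$: (i) $\|\Phi_{S_1}(z)-\Phi_{S_2}(z)\|\le\phi_2\|E\|\,\|z\|$ for all $z$, all GSOs $S_1,S_2$ and all real matrices $E$ with $S_2=S_1+(ES_1+S_1E)$; in this case put $\kappa=1$; or (ii) $\|\Phi_{S_1}(z)-\Phi_{S_2}(z)\|\le\phi_2\|S_1-S_2\|\,\|z\|$ for all $z$ and all GSOs $S_1,S_2$; in this case put $\kappa=2\|S\|$, where $S$ is the GSO fixed below. *Conclusion.*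 Fix a GSO $S$, an architecture as above and $t\ge0$. There is a constant $K$ such that the following holds for all $\varepsilon$. Let $\tilde S$ be a GSO and let $E\in\mathcal E(S,\tilde S)$, with permutation $P$, satisfy $d(S,\tilde S)\le\|E\|\le\varepsilon$. Let $S=V\Lambda V^{\mathsf H}$ and $E=UMU^{\mathsf H}$ with $U,V$ unitary and $\Lambda,M$ diagonal, and put $\delta=(\|U-V\|+1)^2-1$. Suppose the gates are compatible with the relabelling $P$, that is, $\mathcal Q_{\Phi_{PS_1P^{\mathsf T}}(Pz)}\,Pu=P\,\mathcal Q_{\Phi_{S_1}(z)}u$ for all GSOs $S_1$ and $z,u\in\mathbb R^N$, for both gates (this is automatic if $P=\mathrm{Id}$). Let $\|x_s\|\le1$ for all $s$, let $y_t$ be the output of the gated GRNN on $S$ with input $(x_s)$, and let $\tilde y_t$ be the output of the same architecture on $\tilde S$ with the relabelled input $(Px_s)$. Then $$\min_R\|y_t-R^{\mathsf T}\tilde y_t\|\le C(1+\delta\sqrt N)(3t+t^2)\varepsilon+Q\big(\kappa\phi_2+\phi_1C(1+\delta\sqrt N)\big)t^3\varepsilon+Q\phi_1C(1+\delta\sqrt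 N)t^4\varepsilon+K\varepsilon^2,$$ where $R$ ranges over all $N\times N$ permutation matrices. -/

import Mathlib

open Matrix Polynomial
open scoped Matrix.Norms.L2Operator

/-- Graph signals with one feature on `n` nodes, with the Euclidean norm. -/
abbrev Signal (n : ℕ) : Type := EuclideanSpace ℝ (Fin n)

/-- A real matrix, seen as a linear operator on graph signals. Throughout, `‖A‖` for a matrix `A`
is the induced Euclidean operator norm (largest singular value). -/
noncomputable def matOp {n : ℕ} (A : Matrix (Fin n) (Fin n) ℝ) : Signal n →L[ℝ] Signal n :=
  Matrix.toEuclideanCLM (n := Fin n) (𝕜 := ℝ) A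

/-- The graph convolution `x ↦ ∑ k, h_k S ^ k x` with finitely many taps `h_k`; the taps are the
coefficients of the polynomial `h`, whose evaluation is the frequency response of the filter. -/
noncomputable def graphConv {n : ℕ} (h : ℝ[X]) (S : Matrix (Fin n) (Fin n) ℝ) :
    Signal n →L[ℝ] Signal n :=
  matOp (aeval S h)

/-- Pointwise application of an activation function. -/
noncomputable def act {n : ℕ} (σ : ℝ → ℝ) (x : Signal n) : Signal n :=
  WithLp.toLp 2 (fun i => σ (x i))

/-- The permutation matrix of `P`. -/
noncomputable def permMat {n : ℕ} (P : Equiv.Perm (Fin n)) : Matrix (Fin n) (Fin n) ℝ :=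
  P.permMatrix ℝ

/-- The graph shift operators under consideration: symmetric real matrices all of whose
eigenvalues lie in `I`. -/
def shiftOperators (n : ℕ) (I : Set ℝ) : Set (Matrix (Fin n) (Fin n) ℝ) :=
  {S | S.IsSymm ∧ spectrum ℝ S ⊆ I}

/-- `E` is a relative perturbation from `S` to `S'`, with node relabelling `P`:
`Pᵀ S' P = S + (E S + S E)`. -/
def IsRelPerturbation {n : ℕ} (S S' : Matrix (Fin n) (Fin n) ℝ) (P : Equiv.Perm (Fin n))
    (E : Matrix (Fin n) (Fin n) ℝ) : Prop :=
  (permMat P)ᵀ * S' * permMat P = S + (E * S + S * E)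

/-- The set of relative perturbation matrices modulo permutation. -/
def relPerturbations {n : ℕ} (S S' : Matrix (Fin n) (Fin n) ℝ) :
    Set (Matrix (Fin n) (Fin n) ℝ) :=
  {E | ∃ P : Equiv.Perm (Fin n), IsRelPerturbation S S' P E}

/-- The relative distance between two graphs modulo permutation. -/
noncomputable def graphDist {n : ℕ} (S S' : Matrix (Fin n) (Fin n) ℝ) : ℝ :=
  sInf ((fun E => ‖E‖) '' relPerturbations S S')

/-- The filter `h` is integral Lipschitz on `I` with constant `C`:
`|h λ₂ - h λ₁| ≤ C |λ₂ - λ₁| / (|λ₁ + λ₂| / 2)`, written without the division. -/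
def IntegralLipschitzOn (h : ℝ[X]) (I : Set ℝ) (C : ℝ) : Prop :=
  0 ≤ C ∧ ∀ l₁ ∈ I, ∀ l₂ ∈ I,
    |h.eval l₂ - h.eval l₁| * (|l₁ + l₂| / 2) ≤ C * |l₂ - l₁|

/-- A normalized integral Lipschitz filter: the frequency response is at most one in absolute
value. -/
def NormalizedFilterOn (h : ℝ[X]) (I : Set ℝ) (C : ℝ) : Prop :=
  IntegralLipschitzOn h I C ∧ ∀ l ∈ I, |h.eval l| ≤ 1

/-- Normalized Lipschitz activation functions. -/
def NormalizedLipschitz (σ : ℝ → ℝ) : Prop :=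
  σ 0 = 0 ∧ ∀ a b : ℝ, |σ b - σ a| ≤ |b - a|

/-- A gate: a family `op θ` of linear operators acting on graph signals, parametrized by `θ` in a
set `params` of a normed space, together with the model `model S : z ↦ θ` that computes the
parameter from the gate state `z` on the graph with shift operator `S`.
Time gating: `W = ℝ`, `params = [0, 1]`, `op θ = θ • id`.
Node gating: `W = ℝⁿ`, `params = [0, 1]ⁿ`, `op θ = diag θ`.
Any gate given directly by an operator: `W` is the space of operators, `op θ = θ`. -/
structure Gate (n : ℕ) (W : Type*) [NormedAddCommGroup W] where
  params : Set W
  op : W → (Signal n →L[ℝ] Signal n)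
  model : Matrix (Fin n) (Fin n) ℝ → Signal n → W

namespace Gate

variable {n : ℕ} {W : Type*} [NormedAddCommGroup W]

/-- The model takes its values in the admissible parameters, and gates do not amplify. -/
def Normalized (G : Gate n W) (I : Set ℝ) : Prop :=
  (∀ S ∈ shiftOperators n I, ∀ z, G.model S z ∈ G.params) ∧ ∀ θ ∈ G.params, ‖G.op θ‖ ≤ 1

/-- The gate operator is `Q`-Lipschitz in its parameter, in the induced operator norm. -/
def OpLipschitz (G : Gate n W) (Q : ℝ) : Prop :=
  ∀ θ₁ ∈ G.params, ∀ θ₂ ∈ G.params, ‖G.op θ₁ - G.op θ₂‖ ≤ Q * ‖θ₁ - θ₂‖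

/-- The parameter model is `φ₁`-Lipschitz in the gate state. -/
def StateLipschitz (G : Gate n W) (I : Set ℝ) (φ₁ : ℝ) : Prop :=
  ∀ S ∈ shiftOperators n I, ∀ z₁ z₂, ‖G.model S z₁ - G.model S z₂‖ ≤ φ₁ * ‖z₁ - z₂‖

/-- The parameter model is `φ₂`-Lipschitz in the graph, in the induced operator norm, with the
distance of two graphs measured by the norm of the difference of their shift operators. -/
def GraphLipschitz (G : Gate n W) (I : Set ℝ) (φ₂ : ℝ) : Prop :=
  ∀ S₁ ∈ shiftOperators n I, ∀ S₂ ∈ shiftOperators n I, ∀ z,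
    ‖G.model S₁ z - G.model S₂ z‖ ≤ φ₂ * ‖S₁ - S₂‖ * ‖z‖

/-- The parameter model is `φ₂`-Lipschitz in the graph, in the induced operator norm, with the
distance of two graphs measured by relative perturbations `S₂ = S₁ + (E S₁ + S₁ E)`. -/
def RelGraphLipschitz (G : Gate n W) (I : Set ℝ) (φ₂ : ℝ) : Prop :=
  ∀ S₁ ∈ shiftOperators n I, ∀ S₂ ∈ shiftOperators n I, ∀ E, IsRelPerturbation S₁ S₂ 1 E →
    ∀ z, ‖G.model S₁ z - G.model S₂ z‖ ≤ φ₂ * ‖E‖ * ‖z‖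

/-- The gate is compatible with the relabelling `P` of the nodes (always true for `P = 1`). -/
def EquivariantUnder (G : Gate n W) (I : Set ℝ) (P : Equiv.Perm (Fin n)) : Prop :=
  ∀ S ∈ shiftOperators n I, ∀ z u : Signal n,
    G.op (G.model (permMat P * S * (permMat P)ᵀ) (matOp (permMat P) z)) (matOp (permMat P) u)
      = matOp (permMat P) (G.op (G.model S z) u)

end Gate

/-- The recurrence `z₀ = 0`, `z_t = σ (A_S x_t + B_S z_{t-1})` of an ungated graph recurrent
neural network. -/
noncomputable def grnnState {n : ℕ} (σ : ℝ → ℝ) (A B : ℝ[X]) (S : Matrix (Fin n) (Fin n) ℝ)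
    (x : ℕ → Signal n) : ℕ → Signal n
  | 0 => 0
  | t + 1 => act σ (graphConv A S (x (t + 1)) + graphConv B S (grnnState σ A B S x t))

/-- The architecture of a gated graph recurrent neural network with one input, state and gate
state feature: filters and activation functions of the main network (`A`, `B`, `C`, `σ`, `ρ`), of
the input gate (`Ai`, `Bi`, `σi`) and of the forget gate (`Af`, `Bf`, `σf`), and the two gates. -/
structure GatedGRNN (n : ℕ) (Wi Wf : Type*) [NormedAddCommGroup Wi] [NormedAddCommGroup Wf] where
  (A B C Ai Bi Af Bf : ℝ[X])
  (σ ρ σi σf : ℝ → ℝ)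
  inputGate : Gate n Wi
  forgetGate : Gate n Wf

namespace GatedGRNN

variable {n : ℕ} {Wi Wf : Type*} [NormedAddCommGroup Wi] [NormedAddCommGroup Wf]

/-- The parameter of the input gate at time `t`. -/
noncomputable def inputParam (N : GatedGRNN n Wi Wf) (S : Matrix (Fin n) (Fin n) ℝ)
    (x : ℕ → Signal n) (t : ℕ) : Wi :=
  N.inputGate.model S (grnnState N.σi N.Ai N.Bi S x t)

/-- The parameter of the forget gate at time `t`. -/
noncomputable def forgetParam (N : GatedGRNN n Wi Wf) (S : Matrix (Fin n) (Fin n) ℝ)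
    (x : ℕ → Signal n) (t : ℕ) : Wf :=
  N.forgetGate.model S (grnnState N.σf N.Af N.Bf S x t)

/-- The gated state `z₀ = 0`, `z_t = σ (Q̂_t {A_S x_t} + Q̌_t {B_S z_{t-1}})`. -/
noncomputable def state (N : GatedGRNN n Wi Wf) (S : Matrix (Fin n) (Fin n) ℝ)
    (x : ℕ → Signal n) : ℕ → Signal n
  | 0 => 0
  | t + 1 => act N.σ
      (N.inputGate.op (N.inputParam S x (t + 1)) (graphConv N.A S (x (t + 1)))
        + N.forgetGate.op (N.forgetParam S x (t + 1)) (graphConv N.B S (N.state S x t)))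

/-- The output `y_t = ρ (C_S z_t)`. -/
noncomputable def output (N : GatedGRNN n Wi Wf) (S : Matrix (Fin n) (Fin n) ℝ)
    (x : ℕ → Signal n) (t : ℕ) : Signal n :=
  act N.ρ (graphConv N.C S (N.state S x t))

end GatedGRNN

/-- The eigenvector misalignment `δ = (‖U - V‖ + 1)² - 1`. -/
noncomputable def misalignment {n : ℕ} (U V : Matrix (Fin n) (Fin n) ℂ) : ℝ :=
  (‖U - V‖ + 1) ^ 2 - 1

/-- `U diag(m) Uᴴ` is a unitary eigendecomposition of the real matrix `M`. -/
def IsUnitaryEigendecomp {n : ℕ} (M : Matrix (Fin n) (Fin n) ℝ) (U : Matrix (Fin n) (Fin n) ℂ)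
    (m : Fin n → ℂ) : Prop :=
  U ∈ Matrix.unitaryGroup (Fin n) ℂ ∧ M.map Complex.ofReal = U * Matrix.diagonal m * Uᴴ

/-! Since the architecture commutes with relabelling, `R = P` turns the claim into a comparison,
with the same input, of the GSO `S` and `S₁ = Pᵀ S' P = S + X`, where `X = E S + S E`.

For one filter `h`, expand `h(S + X) = h(S) + D X + O(‖X‖²)` (`exists_taylor_aeval`). In an
eigenbasis of `S` the entries of `X` are `(λᵢ + λⱼ) Eᵢⱼ`, and `D` multiplies them by the divided
differences of `h`. The integral Lipschitz condition says exactly that the combined multiplier of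
`Eᵢⱼ` is at most `2C` in absolute value. In that basis `E` is the diagonal matrix of its own
eigenvalues plus a remainder of norm at most `δ‖E‖`. The diagonal part meets the multiplier without
loss; the remainder is estimated through the Frobenius norm, which costs `√N`. The result is `2C(1 +
δ√N)‖E‖ + K‖E‖²` (`exists_norm_aeval_sub_le`).

The rest is error propagation (`GatedGRNN.norm_output_sub_le`). If all filters change by at most `Δ`
and the gate models by at most `η‖z‖`, then states at time `t` have norm at most `t`, gate states
differ by at most `Δ t(t+1)/2`, and a second induction adds up the errors in the gates. The factor 2
in `Δ` cancels the halves from the summation. -/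

theorem Polynomial.aeval_mul_eq_mul_aeval {R A : Type*} [CommSemiring R] [Semiring A] [Algebra R A]
    {a b t : A} (h : a * t = t * b) (p : R[X]) : aeval a p * t = t * aeval b p := by
  induction p using Polynomial.induction_on' with
  | add p q hp hq => simp [add_mul, mul_add, hp, hq]
  | monomial k c =>
    have hk : t * b ^ k = a ^ k * t := SemiconjBy.pow_right (a := t) (x := b) (y := a) h.symm k
    rw [aeval_monomial, aeval_monomial, mul_assoc, ← hk, ← mul_assoc, ← mul_assoc,
      Algebra.commutes]

theorem Polynomial.aeval_diagonal {R 𝕜 ι : Type*} [CommSemiring R] [CommSemiring 𝕜] [Algebra R 𝕜]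
    [Fintype ι] [DecidableEq ι] (d : ι → 𝕜) (p : R[X]) :
    aeval (Matrix.diagonal d) p = Matrix.diagonal fun i => aeval (d i) p := by
  have h := Polynomial.aeval_algHom_apply (Matrix.diagonalAlgHom (n := ι) (α := 𝕜) R) d p
  simp only [Matrix.diagonalAlgHom_apply] at h
  rw [h]
  congr 1
  funext i
  exact (Polynomial.aeval_algHom_apply (Pi.evalAlgHom R (fun _ : ι => 𝕜) i) d p).symm

/-! ### Operator norm, Frobenius norm and complexification -/

namespace Matrix

section RCLike

variable {𝕜 ι : Type*} [RCLike 𝕜] [Fintype ι] [DecidableEq ι]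

theorem l2_opNorm_le_one_of_mem_unitaryGroup {U : Matrix ι ι 𝕜} (hU : U ∈ unitaryGroup ι 𝕜) :
    ‖U‖ ≤ 1 := by
  have h1 : ‖(1 : Matrix ι ι 𝕜)‖ ≤ 1 := by
    rw [← diagonal_one, l2_opNorm_diagonal]
    exact (pi_norm_le_iff_of_nonneg zero_le_one).2 fun i => by simp
  have h2 := l2_opNorm_conjTranspose_mul_self U
  rw [← star_eq_conjTranspose, mem_unitaryGroup_iff'.1 hU] at h2
  nlinarith [norm_nonneg U]

theorem l2_opNorm_unitary_conj_le {U : Matrix ι ι 𝕜} (hU : U ∈ unitaryGroup ι 𝕜)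
    (A : Matrix ι ι 𝕜) : ‖U * A * Uᴴ‖ ≤ ‖A‖ := by
  have h := l2_opNorm_le_one_of_mem_unitaryGroup hU
  have h' : ‖Uᴴ‖ ≤ 1 := by rwa [l2_opNorm_conjTranspose]
  calc ‖U * A * Uᴴ‖ ≤ ‖U‖ * ‖A‖ * ‖Uᴴ‖ := by
        grw [norm_mul_le, norm_mul_le]
    _ ≤ 1 * ‖A‖ * 1 := by gcongr
    _ = ‖A‖ := by ring

theorem l2_opNorm_sq_le_sum (A : Matrix ι ι 𝕜) : ‖A‖ ^ 2 ≤ ∑ i, ∑ j, ‖A i j‖ ^ 2 := by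
  have hnn : 0 ≤ ∑ i, ∑ j, ‖A i j‖ ^ 2 := by positivity
  rw [← Real.le_sqrt (norm_nonneg _) hnn, ← l2_opNorm_toEuclideanCLM]
  refine ContinuousLinearMap.opNorm_le_bound _ (Real.sqrt_nonneg _) fun x => ?_
  rw [← sq_le_sq₀ (norm_nonneg _) (by positivity), mul_pow, Real.sq_sqrt hnn,
    EuclideanSpace.norm_sq_eq, EuclideanSpace.norm_sq_eq, Finset.sum_mul]
  refine Finset.sum_le_sum fun i _ => ?_
  rw [ofLp_toEuclideanCLM]
  calc ‖(A *ᵥ x.ofLp) i‖ ^ 2 ≤ (∑ j, ‖A i j‖ * ‖x j‖) ^ 2 := by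
        gcongr
        refine (norm_sum_le _ _).trans (le_of_eq ?_)
        simp
    _ ≤ _ := Finset.sum_mul_sq_le_sq_mul_sq _ _ _

/-- Each column is the image of a unit vector, so its Euclidean norm is at most `‖A‖`. -/
theorem sum_norm_sq_le_l2_opNorm (A : Matrix ι ι 𝕜) :
    ∑ i, ∑ j, ‖A i j‖ ^ 2 ≤ Fintype.card ι * ‖A‖ ^ 2 := by
  rw [Finset.sum_comm]
  have h : ∀ j, ∑ i, ‖A i j‖ ^ 2 ≤ ‖A‖ ^ 2 := fun j => by
    have h := (toEuclideanCLM (n := ι) (𝕜 := 𝕜) A).le_opNorm (EuclideanSpace.single j 1)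
    rw [l2_opNorm_toEuclideanCLM, PiLp.norm_single, norm_one, mul_one,
      ← sq_le_sq₀ (norm_nonneg _) (norm_nonneg _), EuclideanSpace.norm_sq_eq] at h
    simpa using h
  calc _ ≤ ∑ _j : ι, ‖A‖ ^ 2 := Finset.sum_le_sum fun j _ => h j
    _ = _ := by simp

/-- Bounded entrywise multipliers need not be bounded by the same constant in operator norm, but
they are in Frobenius norm. Passing there and back produces the `√N` of the theorem. -/
theorem l2_opNorm_le_of_norm_entry_le {A B : Matrix ι ι 𝕜} {c : ℝ} (hc : 0 ≤ c)
    (h : ∀ i j, ‖B i j‖ ≤ c * ‖A i j‖) : ‖B‖ ≤ c * √(Fintype.card ι) * ‖A‖ := by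
  rw [← sq_le_sq₀ (norm_nonneg _) (by positivity)]
  calc ‖B‖ ^ 2 ≤ ∑ i, ∑ j, ‖B i j‖ ^ 2 := l2_opNorm_sq_le_sum B
    _ ≤ ∑ i, ∑ j, (c * ‖A i j‖) ^ 2 := by gcongr; exact h _ _
    _ = c ^ 2 * ∑ i, ∑ j, ‖A i j‖ ^ 2 := by simp [mul_pow, Finset.mul_sum]
    _ ≤ c ^ 2 * (Fintype.card ι * ‖A‖ ^ 2) := by gcongr; exact sum_norm_sq_le_l2_opNorm A
    _ = _ := by rw [mul_pow, mul_pow, Real.sq_sqrt (by positivity)]; ring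

end RCLike

/-- A real matrix acts separately on real and imaginary parts, whose squared norms add. This lets
the complex eigendecompositions be used for real operators. -/
theorem l2_opNorm_map_ofReal {ι : Type*} [Fintype ι] [DecidableEq ι] (A : Matrix ι ι ℝ) :
    ‖A.map Complex.ofReal‖ = ‖A‖ := by
  apply le_antisymm
  · rw [← l2_opNorm_toEuclideanCLM (A.map Complex.ofReal)]
    refine ContinuousLinearMap.opNorm_le_bound _ (norm_nonneg _) fun x => ?_
    have hre := (toEuclideanCLM (n := ι) (𝕜 := ℝ) A).le_opNorm (WithLp.toLp 2 fun i => (x i).re)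
    have him := (toEuclideanCLM (n := ι) (𝕜 := ℝ) A).le_opNorm (WithLp.toLp 2 fun i => (x i).im)
    rw [l2_opNorm_toEuclideanCLM, ← sq_le_sq₀ (norm_nonneg _) (by positivity), mul_pow,
      EuclideanSpace.norm_sq_eq, EuclideanSpace.norm_sq_eq] at hre him
    rw [← sq_le_sq₀ (norm_nonneg _) (by positivity), mul_pow,
      EuclideanSpace.norm_sq_eq, EuclideanSpace.norm_sq_eq]
    have key : ∀ z : ℂ, ‖z‖ ^ 2 = ‖z.re‖ ^ 2 + ‖z.im‖ ^ 2 := fun z => by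
      rw [Complex.sq_norm, Complex.normSq_apply]; simp [sq]
    simp only [key, Finset.sum_add_distrib, mul_add]
    refine le_trans (le_of_eq ?_) (add_le_add hre him)
    simp [mulVec, dotProduct]
  · rw [← l2_opNorm_toEuclideanCLM A]
    refine ContinuousLinearMap.opNorm_le_bound _ (norm_nonneg _) fun x => ?_
    have h := (toEuclideanCLM (n := ι) (𝕜 := ℂ) (A.map Complex.ofReal)).le_opNorm
      (WithLp.toLp 2 fun i => (x i : ℂ))
    rw [l2_opNorm_toEuclideanCLM, ← sq_le_sq₀ (norm_nonneg _) (by positivity), mul_pow,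
      EuclideanSpace.norm_sq_eq, EuclideanSpace.norm_sq_eq] at h
    rw [← sq_le_sq₀ (norm_nonneg _) (by positivity), mul_pow,
      EuclideanSpace.norm_sq_eq, EuclideanSpace.norm_sq_eq]
    refine le_trans (le_of_eq ?_) (h.trans (le_of_eq ?_))
    · refine Finset.sum_congr rfl fun i _ => ?_
      rw [ofLp_toEuclideanCLM, ofLp_toEuclideanCLM, ← Complex.norm_real]
      congr 2
      simp [mulVec, dotProduct]
    · simp

theorem aeval_map_ofReal {ι : Type*} [Fintype ι] [DecidableEq ι] (A : Matrix ι ι ℝ) (p : ℝ[X]) :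
    aeval (A.map Complex.ofReal) p = (aeval A p).map Complex.ofReal :=
  Polynomial.aeval_algHom_apply (Complex.ofRealAm.mapMatrix (m := ι)) A p

end Matrix

/-! ### Divided differences and the derivative of a matrix polynomial -/

/-- The first divided difference of `h`, equal to the derivative on the diagonal. -/
noncomputable def divDiff (h : ℝ[X]) (a b : ℝ) : ℝ :=
  if a = b then h.derivative.eval a else (h.eval a - h.eval b) / (a - b)

theorem divDiff_C (c a b : ℝ) : divDiff (C c) a b = 0 := by
  simp [divDiff]

theorem divDiff_add (p q : ℝ[X]) (a b : ℝ) :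
    divDiff (p + q) a b = divDiff p a b + divDiff q a b := by
  unfold divDiff
  split_ifs
  · simp
  · simp only [eval_add]; ring

/-- The Leibniz rule for divided differences, mirrored by the product rule in `exists_taylor_aeval`.
-/
theorem divDiff_mul_X (p : ℝ[X]) (a b : ℝ) :
    divDiff (p * X) a b = divDiff p a b * b + p.eval a := by
  unfold divDiff
  split_ifs with hab
  · subst hab; simp
  · have : a - b ≠ 0 := sub_ne_zero.2 hab
    simp only [eval_mul, eval_X]; field_simp; ring

/-- Off the diagonal this is the integral Lipschitz condition. On the diagonal it follows by letting
`b → a` inside `I`; a nontrivial interval has no isolated points, so such a limit exists at every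
point. -/
theorem abs_divDiff_mul_add_le {h : ℝ[X]} {I : Set ℝ} (hI : I.OrdConnected) (hn : I.Nontrivial)
    {c : ℝ} (hh : IntegralLipschitzOn h I c) {a b : ℝ} (ha : a ∈ I) (hb : b ∈ I) :
    |divDiff h a b * (a + b)| ≤ 2 * c := by
  have off : ∀ {a b : ℝ}, a ∈ I → b ∈ I → a ≠ b →
      |(h.eval a - h.eval b) / (a - b) * (a + b)| ≤ 2 * c := fun {a b} ha hb hab => by
    have h1 := hh.2 b hb a ha
    have h2 : 0 < |a - b| := abs_pos.2 (sub_ne_zero.2 hab)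
    rw [abs_mul, abs_div, div_mul_eq_mul_div, div_le_iff₀ h2]
    rw [add_comm b a] at h1
    linarith
  unfold divDiff
  split_ifs with hab
  · subst hab
    have hacc : (nhdsWithin a {a}ᶜ ⊓ Filter.principal I).NeBot :=
      hI.isPreconnected.preperfect_of_nontrivial hn a ha
    have hder := (hasDerivAt_iff_tendsto_slope.1 (h.hasDerivAt a))
    have hadd : Filter.Tendsto (fun b : ℝ => b + a) (nhdsWithin a {a}ᶜ) (nhds (a + a)) :=
      ((continuous_id.add continuous_const).tendsto a).mono_left nhdsWithin_le_nhds
    have hlim := ((hder.mul hadd).abs).mono_left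
      (inf_le_left (a := nhdsWithin a {a}ᶜ) (b := Filter.principal I))
    refine le_of_tendsto hlim ?_
    have h1 : ∀ᶠ b in nhdsWithin a {a}ᶜ ⊓ Filter.principal I, b ∈ I :=
      Filter.mem_inf_of_right (Filter.mem_principal_self I)
    have h2 : ∀ᶠ b in nhdsWithin a {a}ᶜ ⊓ Filter.principal I, b ≠ a :=
      Filter.mem_inf_of_left self_mem_nhdsWithin
    filter_upwards [h1, h2] with b hb hba
    have := off hb ha hba
    rwa [slope_def_field]
  · exact off ha hb hab

/-- Second-order Taylor estimate for a polynomial of a matrix; in an orthonormal eigenbasis the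
derivative is entrywise multiplication by divided differences. -/
theorem exists_taylor_aeval {ι : Type*} [Fintype ι] [DecidableEq ι] (S : Matrix ι ι ℂ) (r : ℝ)
    (hr : 0 ≤ r) (h : ℝ[X]) :
    ∃ D : Matrix ι ι ℂ → Matrix ι ι ℂ,
      (∃ G, 0 ≤ G ∧ ∀ X, ‖D X‖ ≤ G * ‖X‖) ∧
      (∃ K, 0 ≤ K ∧ ∀ X, ‖X‖ ≤ r → ‖aeval (S + X) h - aeval S h - D X‖ ≤ K * ‖X‖ ^ 2) ∧
      ∀ V ∈ unitaryGroup ι ℂ, ∀ l : ι → ℝ, S = V * diagonal (fun i => (l i : ℂ)) * Vᴴ →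
        ∀ Y, D (V * Y * Vᴴ) = V * (Matrix.of fun i j => (divDiff h (l i) (l j) : ℂ) * Y i j) * Vᴴ := by
  induction h using Polynomial.induction_on with
  | C c =>
    refine ⟨fun _ => 0, ⟨0, le_rfl, by simp⟩, ⟨0, le_rfl, by simp⟩, fun V _ l _ Y => ?_⟩
    have : (Matrix.of fun i j => (divDiff (C c) (l i) (l j) : ℂ) * Y i j) = 0 := by
      ext i j; simp [divDiff_C]
    rw [this]; simp
  | add p q hp hq =>
    obtain ⟨D₁, ⟨G₁, hG₁, hD₁⟩, ⟨K₁, hK₁, hT₁⟩, he₁⟩ := hp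
    obtain ⟨D₂, ⟨G₂, hG₂, hD₂⟩, ⟨K₂, hK₂, hT₂⟩, he₂⟩ := hq
    refine ⟨fun X => D₁ X + D₂ X, ⟨G₁ + G₂, by positivity, fun X => ?_⟩,
      ⟨K₁ + K₂, by positivity, fun X hX => ?_⟩, fun V hV l hl Y => ?_⟩
    · grw [norm_add_le, hD₁ X, hD₂ X, add_mul]
    · rw [map_add, map_add, add_mul]
      refine le_trans (le_of_eq ?_) ((norm_add_le _ _).trans (add_le_add (hT₁ X hX) (hT₂ X hX)))
      congr 1; dsimp only; abel
    · simp only [he₁ V hV l hl, he₂ V hV l hl]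
      rw [← add_mul, ← mul_add]
      congr 2
      ext i j
      simp [divDiff_add, add_mul]
  | monomial k c ih =>
    rw [pow_succ, ← mul_assoc]
    generalize C c * X ^ k = p at ih
    obtain ⟨D, ⟨G, hG, hD⟩, ⟨K, hK, hT⟩, he⟩ := ih
    -- Product rule for the derivative of `T ↦ p(T) T` at `S`. The radius `r` enters because the
    -- Taylor error of `p` gets multiplied by `S + X`; the cross term `D X * X` is quadratic by the
    -- bound `G` on `D`.
    refine ⟨fun X => D X * S + aeval S p * X, ⟨G * ‖S‖ + ‖aeval S p‖, by positivity, fun X => ?_⟩,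
      ⟨K * (‖S‖ + r) + G, by positivity, fun X hX => ?_⟩, fun V hV l hl Y => ?_⟩
    · grw [norm_add_le, norm_mul_le, norm_mul_le, hD X]
      apply le_of_eq; ring
    · have h1 : aeval (S + X) (p * Polynomial.X) - aeval S (p * Polynomial.X)
          - (D X * S + aeval S p * X)
          = (aeval (S + X) p - aeval S p - D X) * (S + X) + D X * X := by
        simp only [map_mul, aeval_X]; noncomm_ring
      rw [h1]
      have h2 : ‖S + X‖ ≤ ‖S‖ + r := (norm_add_le _ _).trans (by gcongr)
      grw [norm_add_le, norm_mul_le, norm_mul_le, hD X, hT X hX, h2]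
      apply le_of_eq; ring
    · have hVV : Vᴴ * V = 1 := mem_unitaryGroup_iff'.1 hV
      have hS : S * V = V * diagonal (fun i => (l i : ℂ)) := by
        rw [hl, mul_assoc, hVV, mul_one]
      have hp : aeval S p * V = V * diagonal (fun i => ((p.eval (l i) : ℝ) : ℂ)) := by
        rw [aeval_mul_eq_mul_aeval hS, aeval_diagonal]
        congr 2; funext i
        exact Polynomial.aeval_algebraMap_apply ℂ (l i) p
      simp only [he V hV l hl]
      have h1 : ∀ Z : Matrix ι ι ℂ, V * Z * Vᴴ * S
          = V * (Z * diagonal (fun i => (l i : ℂ))) * Vᴴ := fun Z => by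
        rw [hl]
        calc _ = V * Z * (Vᴴ * V) * diagonal (fun i => (l i : ℂ)) * Vᴴ := by noncomm_ring
          _ = _ := by rw [hVV]; noncomm_ring
      have h2 : aeval S p * (V * Y * Vᴴ)
          = V * (diagonal (fun i => ((p.eval (l i) : ℝ) : ℂ)) * Y) * Vᴴ := by
        rw [← mul_assoc, ← mul_assoc, hp]; noncomm_ring
      -- In the eigenbasis, right multiplication by `S` scales column `j` by `l j`, and left
      -- multiplication by `p(S)` scales row `i` by `p (l i)`: entrywise this is `divDiff_mul_X`.
      rw [h1, h2, ← add_mul, ← mul_add]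
      congr 2
      ext i j
      simp only [Matrix.add_apply, mul_diagonal, diagonal_mul, of_apply, divDiff_mul_X]
      push_cast; ring

/-! ### Eigendecompositions and stability of a single filter -/

theorem exists_real_eigendecomp {n : ℕ} {I : Set ℝ} {S : Matrix (Fin n) (Fin n) ℝ}
    (hS : S ∈ shiftOperators n I) :
    ∃ U ∈ unitaryGroup (Fin n) ℝ, ∃ d : Fin n → ℝ, (∀ i, d i ∈ I) ∧ S = U * diagonal d * Uᴴ := by
  have hH : S.IsHermitian := by
    rw [IsHermitian, conjTranspose_eq_transpose_of_trivial]; exact hS.1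
  refine ⟨hH.eigenvectorUnitary, hH.eigenvectorUnitary.2, hH.eigenvalues,
    fun i => hS.2 (hH.eigenvalues_mem_spectrum_real i), ?_⟩
  exact hH.spectral_theorem

theorem norm_aeval_le_one {n : ℕ} {I : Set ℝ} {S : Matrix (Fin n) (Fin n) ℝ}
    (hS : S ∈ shiftOperators n I) {h : ℝ[X]} (hh : ∀ l ∈ I, |h.eval l| ≤ 1) :
    ‖aeval S h‖ ≤ 1 := by
  obtain ⟨U, hU, d, hd, hSd⟩ := exists_real_eigendecomp hS
  have hSU : S * U = U * diagonal d := by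
    rw [hSd, mul_assoc, ← star_eq_conjTranspose, mem_unitaryGroup_iff'.1 hU, mul_one]
  have h1 : aeval S h = U * diagonal (fun i => h.eval (d i)) * Uᴴ := by
    calc aeval S h = aeval S h * (U * Uᴴ) := by
          rw [← star_eq_conjTranspose, mem_unitaryGroup_iff.1 hU, mul_one]
      _ = _ := by
          rw [← mul_assoc, aeval_mul_eq_mul_aeval hSU, aeval_diagonal]
          simp only [coe_aeval_eq_eval]
  rw [h1]
  grw [l2_opNorm_unitary_conj_le hU, l2_opNorm_diagonal]
  exact (pi_norm_le_iff_of_nonneg zero_le_one).2 fun i => hh _ (hd i)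

/-- A symmetric matrix with only one possible eigenvalue is scalar. This settles the degenerate
intervals, to which `abs_divDiff_mul_add_le` does not apply. -/
theorem shiftOperators_subsingleton {n : ℕ} {I : Set ℝ} (hI : I.Subsingleton) :
    (shiftOperators n I).Subsingleton := by
  intro S hS T hT
  obtain ⟨U, hU, d, hd, hSd⟩ := exists_real_eigendecomp hS
  obtain ⟨W, hW, e, he, hTe⟩ := exists_real_eigendecomp hT
  rcases I.eq_empty_or_nonempty with rfl | ⟨c, hc⟩
  · ext i; exact (hd i).elim
  · have hdc : d = fun _ => c := funext fun i => hI (hd i) hc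
    have hec : e = fun _ => c := funext fun i => hI (he i) hc
    have hdiag : (diagonal fun _ : Fin n => c) = c • (1 : Matrix (Fin n) (Fin n) ℝ) :=
      (smul_one_eq_diagonal c).symm
    rw [hSd, hTe, hdc, hec, hdiag, mul_smul_comm, mul_smul_comm, mul_one, mul_one,
      smul_mul_assoc, smul_mul_assoc, ← star_eq_conjTranspose, ← star_eq_conjTranspose,
      mem_unitaryGroup_iff.1 hU, mem_unitaryGroup_iff.1 hW]

/-- The diagonal factor is unitarily conjugate to a Hermitian matrix, so it is real. Each entry `l
i` lies in the spectrum because `det (l i - S)` is the product of all `l i - l j`, which contains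
the factor `j = i`. -/
theorem IsUnitaryEigendecomp.exists_real {n : ℕ} {I : Set ℝ} {S : Matrix (Fin n) (Fin n) ℝ}
    (hS : S ∈ shiftOperators n I) {V : Matrix (Fin n) (Fin n) ℂ} {l : Fin n → ℂ}
    (h : IsUnitaryEigendecomp S V l) :
    ∃ d : Fin n → ℝ, (∀ i, d i ∈ I) ∧ l = fun i => (d i : ℂ) := by
  obtain ⟨hV, hSV⟩ := h
  have hVV : Vᴴ * V = 1 := mem_unitaryGroup_iff'.1 hV
  have hVV' : V * Vᴴ = 1 := mem_unitaryGroup_iff.1 hV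
  have hD : diagonal l = Vᴴ * S.map Complex.ofReal * V := by
    rw [hSV]
    calc diagonal l = 1 * diagonal l * 1 := by simp
      _ = _ := by rw [← hVV]; noncomm_ring
  have hSH : (S.map Complex.ofReal)ᴴ = S.map Complex.ofReal := by
    ext i j
    simp [conjTranspose_apply, hS.1.apply i j]
  have hDH : (diagonal l)ᴴ = diagonal l := by
    rw [hD]
    simp only [conjTranspose_mul, hSH, conjTranspose_conjTranspose, mul_assoc]
  have hreal : ∀ i, ((l i).re : ℂ) = l i := fun i => by
    have := congrFun (congrFun hDH i) i
    rw [conjTranspose_apply, diagonal_apply_eq] at this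
    exact Complex.conj_eq_iff_re.1 this
  refine ⟨fun i => (l i).re, fun i => hS.2 ?_, funext fun i => (hreal i).symm⟩
  rw [spectrum.mem_iff, isUnit_iff_isUnit_det, isUnit_iff_ne_zero, not_not]
  apply Complex.ofReal_injective
  have h1 : (algebraMap ℝ (Matrix (Fin n) (Fin n) ℝ) (l i).re - S).map Complex.ofReal
      = V * diagonal (fun j => l i - l j) * Vᴴ := by
    have h2 : (diagonal fun j => l i - l j) = l i • (1 : Matrix (Fin n) (Fin n) ℂ) - diagonal l := by
      rw [smul_one_eq_diagonal, diagonal_sub]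
    rw [h2, mul_sub, sub_mul, ← hSV, mul_smul_comm, mul_one, smul_mul_assoc, hVV',
      smul_one_eq_diagonal]
    ext a b
    by_cases hab : a = b
    · subst hab; simp [algebraMap_matrix_apply, hreal]
    · simp [algebraMap_matrix_apply, hab]
  have h3 := Complex.ofRealHom.map_det (algebraMap ℝ (Matrix (Fin n) (Fin n) ℝ) (l i).re - S)
  rw [RingHom.mapMatrix_apply] at h3
  refine Eq.trans h3 (Eq.trans (congrArg det h1) ?_)
  rw [det_mul, det_mul, det_diagonal, Finset.prod_eq_zero (Finset.mem_univ i) (sub_self _)]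
  simp

theorem misalignment_nonneg {n : ℕ} (U V : Matrix (Fin n) (Fin n) ℂ) : 0 ≤ misalignment U V := by
  unfold misalignment
  nlinarith [norm_nonneg (U - V)]

theorem IsUnitaryEigendecomp.norm_le {n : ℕ} {E : Matrix (Fin n) (Fin n) ℝ}
    {U : Matrix (Fin n) (Fin n) ℂ} {m : Fin n → ℂ} (h : IsUnitaryEigendecomp E U m) :
    ‖m‖ ≤ ‖E‖ := by
  obtain ⟨hU, hEU⟩ := h
  have hUU : Uᴴ * U = 1 := mem_unitaryGroup_iff'.1 hU
  have hD : diagonal m = Uᴴ * E.map Complex.ofReal * Uᴴᴴ := by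
    rw [hEU, conjTranspose_conjTranspose]
    calc diagonal m = 1 * diagonal m * 1 := by simp
      _ = _ := by rw [← hUU]; noncomm_ring
  rw [← l2_opNorm_diagonal, hD, ← l2_opNorm_map_ofReal E]
  exact l2_opNorm_unitary_conj_le (Unitary.star_mem hU) _

/-- In a basis `V` near the eigenbasis `U`, a normal matrix is close to its diagonal form. -/
theorem IsUnitaryEigendecomp.norm_offdiag_le {n : ℕ} {E : Matrix (Fin n) (Fin n) ℝ}
    {U V : Matrix (Fin n) (Fin n) ℂ} {m : Fin n → ℂ} (h : IsUnitaryEigendecomp E U m)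
    (hV : V ∈ unitaryGroup (Fin n) ℂ) :
    ‖Vᴴ * E.map Complex.ofReal * V - diagonal m‖ ≤ misalignment U V * ‖E‖ := by
  have hm := h.norm_le
  obtain ⟨hU, hEU⟩ := h
  have hVV : Vᴴ * V = 1 := mem_unitaryGroup_iff'.1 hV
  -- With `W = U - V`, expand `U M Uᴴ - V M Vᴴ = W M Wᴴ + V M Wᴴ + W M Vᴴ`; the norms add up to at
  -- most `(‖W‖² + 2‖W‖)‖m‖ = δ‖m‖`.
  have h1 : Vᴴ * E.map Complex.ofReal * V - diagonal m
      = Vᴴ * ((U - V) * diagonal m * (U - V)ᴴ + V * diagonal m * (U - V)ᴴ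
          + (U - V) * diagonal m * Vᴴ) * Vᴴᴴ := by
    rw [conjTranspose_conjTranspose, hEU, conjTranspose_sub]
    calc Vᴴ * (U * diagonal m * Uᴴ) * V - diagonal m
        = Vᴴ * (U * diagonal m * Uᴴ) * V - 1 * diagonal m * 1 := by simp
      _ = _ := by rw [← hVV]; noncomm_ring
  rw [h1]
  refine (l2_opNorm_unitary_conj_le (Unitary.star_mem hV) _).trans ?_
  have hV1 := l2_opNorm_le_one_of_mem_unitaryGroup hV
  have hV2 : ‖Vᴴ‖ ≤ 1 := by rwa [l2_opNorm_conjTranspose]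
  grw [norm_add_le, norm_add_le, norm_mul_le, norm_mul_le, norm_mul_le, norm_mul_le, norm_mul_le,
    norm_mul_le, hV1, hV2, l2_opNorm_conjTranspose, l2_opNorm_diagonal, hm]
  unfold misalignment
  apply le_of_eq; ring

/-- Stability of an integral Lipschitz filter under relative perturbations of the graph. -/
theorem exists_norm_aeval_sub_le {n : ℕ} {I : Set ℝ} (hI : I.OrdConnected)
    {S : Matrix (Fin n) (Fin n) ℝ} (hS : S ∈ shiftOperators n I) {h : ℝ[X]} {c : ℝ}
    (hh : NormalizedFilterOn h I c) :
    ∃ K, 0 ≤ K ∧ ∀ (S₁ E : Matrix (Fin n) (Fin n) ℝ) (V U : Matrix (Fin n) (Fin n) ℂ)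
      (l m : Fin n → ℂ), S₁ ∈ shiftOperators n I → S₁ = S + (E * S + S * E) →
      IsUnitaryEigendecomp S V l → IsUnitaryEigendecomp E U m →
      ‖aeval S₁ h - aeval S h‖
        ≤ 2 * (c * (1 + misalignment U V * √(n : ℝ))) * ‖E‖ + K * ‖E‖ ^ 2 := by
  have hc : 0 ≤ c := hh.1.1
  obtain ⟨D, -, ⟨K, hK, hT⟩, hD⟩ :=
    exists_taylor_aeval (S.map Complex.ofReal) (2 * ‖S‖) (by positivity) h
  -- The Taylor constant serves for `‖E‖ ≤ 1`, where `‖X‖ ≤ 2‖S‖‖E‖ ≤ 2‖S‖`. For `‖E‖ > 1` both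
  -- filters have norm at most 1, and `2 ≤ 2‖E‖²`.
  refine ⟨max 2 (K * (2 * ‖S‖) ^ 2), by positivity, fun S₁ E V U l m hS₁ hE hdS hdE => ?_⟩
  have hδ := misalignment_nonneg U V
  rcases I.subsingleton_or_nontrivial with hsub | hnt
  · rw [shiftOperators_subsingleton hsub hS₁ hS, sub_self, norm_zero]
    positivity
  rcases le_or_gt ‖E‖ 1 with hE1 | hE1
  swap
  · have h1 : ‖aeval S₁ h - aeval S h‖ ≤ 2 := by
      grw [norm_sub_le, norm_aeval_le_one hS₁ hh.2, norm_aeval_le_one hS hh.2]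
      norm_num
    have h2 : (2 : ℝ) ≤ max 2 (K * (2 * ‖S‖) ^ 2) * ‖E‖ ^ 2 := by
      have : (1 : ℝ) ≤ ‖E‖ ^ 2 := one_le_pow₀ hE1.le
      nlinarith [le_max_left (2 : ℝ) (K * (2 * ‖S‖) ^ 2)]
    have h3 : 0 ≤ 2 * (c * (1 + misalignment U V * √(n : ℝ))) * ‖E‖ := by positivity
    linarith
  obtain ⟨d, hd, rfl⟩ := hdS.exists_real hS
  have hV := hdS.1
  have hVV' : V * Vᴴ = 1 := mem_unitaryGroup_iff.1 hV
  set X := E * S + S * E with hX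
  set F := Vᴴ * E.map Complex.ofReal * V - diagonal m with hF
  have hXn : ‖X‖ ≤ 2 * ‖S‖ * ‖E‖ := by
    grw [hX, norm_add_le, norm_mul_le, norm_mul_le]
    apply le_of_eq; ring
  have hXc : ‖X.map Complex.ofReal‖ ≤ 2 * ‖S‖ := by
    rw [l2_opNorm_map_ofReal]
    exact hXn.trans (mul_le_of_le_one_right (by positivity) hE1)
  have hmapmul : ∀ A B : Matrix (Fin n) (Fin n) ℝ,
      (A * B).map Complex.ofReal = A.map Complex.ofReal * B.map Complex.ofReal :=
    fun A B => Matrix.map_mul (f := Complex.ofRealHom)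
  have hmapadd : ∀ A B : Matrix (Fin n) (Fin n) ℝ,
      (A + B).map Complex.ofReal = A.map Complex.ofReal + B.map Complex.ofReal :=
    fun A B => Matrix.map_add _ Complex.ofReal_add A B
  have hXV : X.map Complex.ofReal
      = V * ((F + diagonal m) * diagonal (fun i => (d i : ℂ))
          + diagonal (fun i => (d i : ℂ)) * (F + diagonal m)) * Vᴴ := by
    rw [hX, hmapadd, hmapmul, hmapmul, hF, sub_add_cancel, hdS.2]
    calc _ = 1 * E.map Complex.ofReal * (V * diagonal (fun i => (d i : ℂ)) * Vᴴ)
          + V * diagonal (fun i => (d i : ℂ)) * Vᴴ * E.map Complex.ofReal * 1 := by simp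
      _ = _ := by rw [← hVV']; noncomm_ring
  have hDX : ‖D (X.map Complex.ofReal)‖
      ≤ 2 * (c * (1 + misalignment U V * √(n : ℝ))) * ‖E‖ := by
    rw [hXV, hD V hV d hdS.2]
    refine (l2_opNorm_unitary_conj_le hV _).trans ?_
    -- The factor `d i + d j` coming from `E S + S E` joins the divided difference. The diagonal
    -- summand is bounded entry by entry; only the summand with `F` pays `√n`.
    have hsplit : (Matrix.of fun i j => (divDiff h (d i) (d j) : ℂ) *
          ((F + diagonal m) * diagonal (fun i => (d i : ℂ))
          + diagonal (fun i => (d i : ℂ)) * (F + diagonal m)) i j)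
        = (Matrix.of fun i j => ((divDiff h (d i) (d j) * (d i + d j) : ℝ) : ℂ) * F i j)
          + diagonal fun i => ((divDiff h (d i) (d i) * (d i + d i) : ℝ) : ℂ) * m i := by
      ext i j
      by_cases hij : i = j
      · subst hij
        simp [mul_diagonal, diagonal_mul]; ring
      · simp [mul_diagonal, diagonal_mul, hij]; ring
    rw [hsplit]
    have hentry : ∀ i j, ‖((divDiff h (d i) (d j) * (d i + d j) : ℝ) : ℂ)‖ ≤ 2 * c := fun i j => by
      rw [Complex.norm_real]
      exact abs_divDiff_mul_add_le hI hnt hh.1 (hd i) (hd j)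
    have h1 := l2_opNorm_le_of_norm_entry_le (c := 2 * c) (A := F)
      (B := Matrix.of fun i j => ((divDiff h (d i) (d j) * (d i + d j) : ℝ) : ℂ) * F i j)
      (by positivity) fun i j => by
        rw [of_apply, norm_mul]
        gcongr
        exact hentry i j
    have h2 : ‖diagonal fun i => ((divDiff h (d i) (d i) * (d i + d i) : ℝ) : ℂ) * m i‖
        ≤ 2 * c * ‖E‖ := by
      rw [l2_opNorm_diagonal]
      refine (pi_norm_le_iff_of_nonneg (by positivity)).2 fun i => ?_
      rw [norm_mul]
      gcongr
      · exact hentry i i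
      · exact (norm_le_pi_norm m i).trans hdE.norm_le
    have h3 : ‖F‖ ≤ misalignment U V * ‖E‖ := hdE.norm_offdiag_le hV
    rw [Fintype.card_fin] at h1
    grw [norm_add_le, h1, h2, h3]
    apply le_of_eq; ring
  have hrem := hT _ hXc
  have hmap : aeval (S.map Complex.ofReal + X.map Complex.ofReal) h
      - aeval (S.map Complex.ofReal) h = (aeval S₁ h - aeval S h).map Complex.ofReal := by
    rw [← hmapadd, aeval_map_ofReal, aeval_map_ofReal, ← hE]
    exact (Matrix.map_sub _ Complex.ofReal_sub _ _).symm
  rw [← l2_opNorm_map_ofReal, ← hmap]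
  rw [l2_opNorm_map_ofReal] at hrem
  have hquad : K * ‖X‖ ^ 2 ≤ max 2 (K * (2 * ‖S‖) ^ 2) * ‖E‖ ^ 2 := by
    grw [hXn, ← le_max_right]
    apply le_of_eq; ring
  have htri := norm_add_le (aeval (S.map Complex.ofReal + X.map Complex.ofReal) h
      - aeval (S.map Complex.ofReal) h - D (X.map Complex.ofReal)) (D (X.map Complex.ofReal))
  rw [sub_add_cancel] at htri
  linarith

/-! ### Signals, relabelling and the ungated recurrence -/

section Signals

variable {n : ℕ}

theorem matOp_mul_apply (A B : Matrix (Fin n) (Fin n) ℝ) (x : Signal n) :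
    matOp (A * B) x = matOp A (matOp B x) := by
  simp [matOp]

theorem matOp_one_apply (x : Signal n) : matOp (1 : Matrix (Fin n) (Fin n) ℝ) x = x := by
  simp [matOp]

theorem matOp_apply_le (A : Matrix (Fin n) (Fin n) ℝ) (x : Signal n) :
    ‖matOp A x‖ ≤ ‖A‖ * ‖x‖ :=
  (matOp A).le_opNorm x

theorem permMat_transpose_mul_self (P : Equiv.Perm (Fin n)) :
    (permMat P)ᵀ * permMat P = 1 := by
  rw [permMat, transpose_permMatrix, ← permMatrix_mul, mul_inv_cancel, permMatrix_one]

theorem permMat_mul_transpose_self (P : Equiv.Perm (Fin n)) :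
    permMat P * (permMat P)ᵀ = 1 :=
  mul_eq_one_comm.1 (permMat_transpose_mul_self P)

theorem permMat_one : permMat (1 : Equiv.Perm (Fin n)) = 1 := permMatrix_one

theorem norm_act_sub_le {σ : ℝ → ℝ} (hσ : NormalizedLipschitz σ) (x y : Signal n) :
    ‖act σ x - act σ y‖ ≤ ‖x - y‖ := by
  rw [← sq_le_sq₀ (norm_nonneg _) (norm_nonneg _), EuclideanSpace.norm_sq_eq,
    EuclideanSpace.norm_sq_eq]
  refine Finset.sum_le_sum fun i _ => ?_
  gcongr
  exact hσ.2 (y i) (x i)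

theorem norm_act_le {σ : ℝ → ℝ} (hσ : NormalizedLipschitz σ) (x : Signal n) :
    ‖act σ x‖ ≤ ‖x‖ := by
  have h0 : act σ (0 : Signal n) = 0 := by
    ext i; simp [act, hσ.1]
  simpa [h0] using norm_act_sub_le hσ x 0

theorem act_matOp_permMat (σ : ℝ → ℝ) (P : Equiv.Perm (Fin n)) (x : Signal n) :
    act σ (matOp (permMat P) x) = matOp (permMat P) (act σ x) := by
  ext i
  simp [act, matOp, permMat, permMatrix_mulVec]

theorem permMat_conj_mem_shiftOperators {I : Set ℝ} {S : Matrix (Fin n) (Fin n) ℝ}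
    (hS : S ∈ shiftOperators n I) (P : Equiv.Perm (Fin n)) :
    (permMat P)ᵀ * S * permMat P ∈ shiftOperators n I := by
  refine ⟨?_, ?_⟩
  · rw [IsSymm, transpose_mul, transpose_mul, transpose_transpose, hS.1.eq, mul_assoc]
  · let u : (Matrix (Fin n) (Fin n) ℝ)ˣ :=
      ⟨(permMat P)ᵀ, permMat P, permMat_transpose_mul_self P, permMat_mul_transpose_self P⟩
    exact (spectrum.units_conjugate (R := ℝ) (a := S) (u := u)).trans_subset hS.2

theorem norm_graphConv_apply_le {I : Set ℝ} {S : Matrix (Fin n) (Fin n) ℝ}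
    (hS : S ∈ shiftOperators n I) {h : ℝ[X]} {c : ℝ} (hh : NormalizedFilterOn h I c)
    (x : Signal n) : ‖graphConv h S x‖ ≤ ‖x‖ := by
  grw [graphConv, matOp_apply_le, norm_aeval_le_one hS hh.2, one_mul]

theorem graphConv_matOp {S T A : Matrix (Fin n) (Fin n) ℝ} (hA : T * A = A * S) (h : ℝ[X])
    (x : Signal n) : graphConv h T (matOp A x) = matOp A (graphConv h S x) := by
  rw [graphConv, graphConv, ← matOp_mul_apply, aeval_mul_eq_mul_aeval hA, matOp_mul_apply]

theorem norm_graphConv_sub_le {S T : Matrix (Fin n) (Fin n) ℝ} {h : ℝ[X]} {Δ : ℝ}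
    (hΔ : ‖aeval T h - aeval S h‖ ≤ Δ) (x : Signal n) :
    ‖graphConv h S x - graphConv h T x‖ ≤ Δ * ‖x‖ := by
  have h1 : graphConv h S x - graphConv h T x = matOp (aeval S h - aeval T h) x := by
    simp [graphConv, matOp]
  rw [h1]
  grw [matOp_apply_le, norm_sub_rev, hΔ]

variable {I : Set ℝ} {σ : ℝ → ℝ} {A B : ℝ[X]} {cA cB : ℝ} {S T : Matrix (Fin n) (Fin n) ℝ}
  {x : ℕ → Signal n}

theorem norm_grnnState_le (hσ : NormalizedLipschitz σ) (hA : NormalizedFilterOn A I cA)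
    (hB : NormalizedFilterOn B I cB) (hS : S ∈ shiftOperators n I) (hx : ∀ s, ‖x s‖ ≤ 1) (t : ℕ) :
    ‖grnnState σ A B S x t‖ ≤ t := by
  induction t with
  | zero => simp [grnnState]
  | succ t ih =>
    grw [grnnState, norm_act_le hσ, norm_add_le, norm_graphConv_apply_le hS hA,
      norm_graphConv_apply_le hS hB, hx, ih]
    push_cast; linarith

/-- Step `t + 1` adds at most `Δ` from the filter on the input and `Δ t` from the filter on the
state, of norm at most `t`; the old error is not amplified. Hence `Δ (1 + ⋯ + t)` at time `t`. -/
theorem norm_grnnState_sub_le (hσ : NormalizedLipschitz σ) (hA : NormalizedFilterOn A I cA)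
    (hB : NormalizedFilterOn B I cB) (hS : S ∈ shiftOperators n I) (hT : T ∈ shiftOperators n I)
    (hx : ∀ s, ‖x s‖ ≤ 1) {Δ : ℝ} (hΔ : 0 ≤ Δ) (hΔA : ‖aeval T A - aeval S A‖ ≤ Δ)
    (hΔB : ‖aeval T B - aeval S B‖ ≤ Δ) (t : ℕ) :
    ‖grnnState σ A B S x t - grnnState σ A B T x t‖ ≤ Δ * (t * (t + 1) / 2) := by
  induction t with
  | zero => simp [grnnState]
  | succ t ih =>
    have hz := norm_grnnState_le hσ hA hB hS hx t
    rw [grnnState, grnnState]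
    set z := grnnState σ A B S x t
    set w := grnnState σ A B T x t
    have h1 : graphConv A S (x (t + 1)) + graphConv B S z
        - (graphConv A T (x (t + 1)) + graphConv B T w)
        = (graphConv A S (x (t + 1)) - graphConv A T (x (t + 1)))
          + (graphConv B S z - graphConv B T z) + graphConv B T (z - w) := by
      rw [map_sub]; abel
    grw [norm_act_sub_le hσ, h1, norm_add_le, norm_add_le, norm_graphConv_sub_le hΔA,
      norm_graphConv_sub_le hΔB, norm_graphConv_apply_le hT hB, hx, ih, hz]
    push_cast
    apply le_of_eq; ring

theorem grnnState_matOp_permMat {P : Equiv.Perm (Fin n)}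
    (hST : T * permMat P = permMat P * S) (t : ℕ) :
    grnnState σ A B T (fun s => matOp (permMat P) (x s)) t
      = matOp (permMat P) (grnnState σ A B S x t) := by
  induction t with
  | zero => simp [grnnState]
  | succ t ih =>
    rw [grnnState, grnnState, ih, graphConv_matOp hST, graphConv_matOp hST, ← map_add,
      act_matOp_permMat]

/-! ### Gates and the gated recurrence -/

namespace Gate

variable {W : Type*} [NormedAddCommGroup W] {G : Gate n W}

theorem norm_op_model_apply_le (hG : G.Normalized I) (hS : S ∈ shiftOperators n I)
    (z u : Signal n) : ‖G.op (G.model S z) u‖ ≤ ‖u‖ := by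
  grw [(G.op _).le_opNorm, hG.2 _ (hG.1 S hS z), one_mul]

/-- The parameters are compared through `G.model T z`: changing the graph at fixed `z` costs `η a`,
then changing the state on `T` costs `φ₁ b`. -/
theorem norm_op_model_sub_le (hG : G.Normalized I) {Q φ₁ : ℝ} (hQ : 0 ≤ Q)
    (hGQ : G.OpLipschitz Q) (hGφ : G.StateLipschitz I φ₁) (hS : S ∈ shiftOperators n I)
    (hT : T ∈ shiftOperators n I) (hφ₁ : 0 ≤ φ₁) {η : ℝ} (hη : 0 ≤ η)
    (hGη : ∀ z, ‖G.model S z - G.model T z‖ ≤ η * ‖z‖) {z w : Signal n} {a b : ℝ}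
    (hz : ‖z‖ ≤ a) (hzw : ‖z - w‖ ≤ b) (u : Signal n) :
    ‖G.op (G.model S z) u - G.op (G.model T w) u‖ ≤ Q * (η * a + φ₁ * b) * ‖u‖ := by
  have h1 : ‖G.model S z - G.model T w‖ ≤ η * a + φ₁ * b := by
    grw [norm_sub_le_norm_sub_add_norm_sub _ (G.model T z), hGη, hGφ T hT z w, hz, hzw]
  rw [← _root_.sub_apply]
  grw [ContinuousLinearMap.le_opNorm, hGQ _ (hG.1 S hS z) _ (hG.1 T hT w), h1]

end Gate

namespace GatedGRNN

variable {Wi Wf : Type*} [NormedAddCommGroup Wi] [NormedAddCommGroup Wf] {net : GatedGRNN n Wi Wf}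

/-- Filters commute with relabelling because intertwining passes to polynomials, activations because
they act entrywise, gates by assumption. -/
theorem output_matOp_permMat {P : Equiv.Perm (Fin n)} (hS : S ∈ shiftOperators n I)
    (hST : T = permMat P * S * (permMat P)ᵀ) (hi : net.inputGate.EquivariantUnder I P)
    (hf : net.forgetGate.EquivariantUnder I P) (t : ℕ) :
    net.output T (fun s => matOp (permMat P) (x s)) t
      = matOp (permMat P) (net.output S x t) := by
  have hTP : T * permMat P = permMat P * S := by
    rw [hST, mul_assoc, permMat_transpose_mul_self, mul_one]
  have hstate : ∀ t, net.state T (fun s => matOp (permMat P) (x s)) t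
      = matOp (permMat P) (net.state S x t) := fun t => by
    induction t with
    | zero => simp [state]
    | succ t ih =>
      rw [state, state, inputParam, forgetParam, ih, grnnState_matOp_permMat hTP,
        grnnState_matOp_permMat hTP, graphConv_matOp hTP, graphConv_matOp hTP, hST,
        hi S hS, hf S hS, ← map_add, act_matOp_permMat]
      rfl
  rw [output, output, hstate, graphConv_matOp hTP, act_matOp_permMat]

/-- Stability of a gated GRNN whose filters differ by at most `Δ` between the graphs `S` and `T`,
and whose gate models differ by at most `η`. -/
theorem norm_output_sub_le {cA cB cC cAi cBi cAf cBf : ℝ}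
    (hA : NormalizedFilterOn net.A I cA) (hB : NormalizedFilterOn net.B I cB)
    (hC : NormalizedFilterOn net.C I cC)
    (hAi : NormalizedFilterOn net.Ai I cAi) (hBi : NormalizedFilterOn net.Bi I cBi)
    (hAf : NormalizedFilterOn net.Af I cAf) (hBf : NormalizedFilterOn net.Bf I cBf)
    (hσ : NormalizedLipschitz net.σ) (hρ : NormalizedLipschitz net.ρ)
    (hσi : NormalizedLipschitz net.σi) (hσf : NormalizedLipschitz net.σf)
    (hGi : net.inputGate.Normalized I) (hGf : net.forgetGate.Normalized I)
    {Q φ₁ : ℝ} (hQ : 0 ≤ Q) (hφ₁ : 0 ≤ φ₁)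
    (hQi : net.inputGate.OpLipschitz Q) (hQf : net.forgetGate.OpLipschitz Q)
    (hφi : net.inputGate.StateLipschitz I φ₁) (hφf : net.forgetGate.StateLipschitz I φ₁)
    (hS : S ∈ shiftOperators n I) (hT : T ∈ shiftOperators n I) (hx : ∀ s, ‖x s‖ ≤ 1)
    {Δ η : ℝ} (hΔ : 0 ≤ Δ) (hη : 0 ≤ η)
    (hΔs : ∀ h ∈ [net.A, net.B, net.C, net.Ai, net.Bi, net.Af, net.Bf],
      ‖aeval T h - aeval S h‖ ≤ Δ)
    (hηi : ∀ z, ‖net.inputGate.model S z - net.inputGate.model T z‖ ≤ η * ‖z‖)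
    (hηf : ∀ z, ‖net.forgetGate.model S z - net.forgetGate.model T z‖ ≤ η * ‖z‖) (t : ℕ) :
    ‖net.output S x t - net.output T x t‖
      ≤ Δ * ((t ^ 2 + 3 * t) / 2) + Q * φ₁ * Δ * ((t ^ 3 + t ^ 4) / 2) + Q * η * t ^ 3 := by
  simp only [List.mem_cons, List.not_mem_nil, or_false, forall_eq_or_imp, forall_eq] at hΔs
  obtain ⟨dA, dB, dC, dAi, dBi, dAf, dBf⟩ := hΔs
  have hnorm : ∀ t, ‖net.state S x t‖ ≤ t := fun t => by
    induction t with
    | zero => simp [state]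
    | succ t ih =>
      grw [state, norm_act_le hσ, norm_add_le, inputParam, forgetParam,
        Gate.norm_op_model_apply_le hGi hS, Gate.norm_op_model_apply_le hGf hS,
        norm_graphConv_apply_le hS hA, norm_graphConv_apply_le hS hB, hx, ih]
      push_cast; linarith
  have hdiff : ∀ t, ‖net.state S x t - net.state T x t‖
      ≤ Δ * (t * (t + 1) / 2) + Q * φ₁ * Δ * ((t ^ 3 + t ^ 4) / 2) + Q * η * t ^ 3 := fun t => by
    induction t with
    | zero => simp [state]
    | succ t ih =>
      have hi := Gate.norm_op_model_sub_le hGi hQ hQi hφi hS hT hφ₁ hη hηi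
        (norm_grnnState_le hσi hAi hBi hS hx (t + 1))
        (norm_grnnState_sub_le hσi hAi hBi hS hT hx hΔ dAi dBi (t + 1))
      have hf := Gate.norm_op_model_sub_le hGf hQ hQf hφf hS hT hφ₁ hη hηf
        (norm_grnnState_le hσf hAf hBf hS hx (t + 1))
        (norm_grnnState_sub_le hσf hAf hBf hS hT hx hΔ dAf dBf (t + 1))
      have hti := fun u => Gate.norm_op_model_apply_le hGi hT
        (grnnState net.σi net.Ai net.Bi T x (t + 1)) u
      have htf := fun u => Gate.norm_op_model_apply_le hGf hT
        (grnnState net.σf net.Af net.Bf T x (t + 1)) u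
      have hz := hnorm t
      rw [state, state]
      change ∀ u, ‖net.inputGate.op (net.inputParam S x (t + 1)) u
        - net.inputGate.op (net.inputParam T x (t + 1)) u‖ ≤ _ at hi
      change ∀ u, ‖net.forgetGate.op (net.forgetParam S x (t + 1)) u
        - net.forgetGate.op (net.forgetParam T x (t + 1)) u‖ ≤ _ at hf
      change ∀ u, ‖net.inputGate.op (net.inputParam T x (t + 1)) u‖ ≤ _ at hti
      change ∀ u, ‖net.forgetGate.op (net.forgetParam T x (t + 1)) u‖ ≤ _ at htf
      set z := net.state S x t
      set w := net.state T x t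
      set iS := net.inputGate.op (net.inputParam S x (t + 1))
      set iT := net.inputGate.op (net.inputParam T x (t + 1))
      set fS := net.forgetGate.op (net.forgetParam S x (t + 1))
      set fT := net.forgetGate.op (net.forgetParam T x (t + 1))
      set q := Q * (η * (t + 1 : ℕ) + φ₁ * (Δ * ((t + 1 : ℕ) * ((t + 1 : ℕ) + 1) / 2))) with hq
      have hq0 : 0 ≤ q := by positivity
      -- One ingredient is exchanged at a time. Gate differences act on signals filtered on `S`, of
      -- norm at most `1` and `t`; the other terms carry a gate on `T`, of norm at most 1.
      have h1 : iS (graphConv net.A S (x (t + 1))) + fS (graphConv net.B S z)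
          - (iT (graphConv net.A T (x (t + 1))) + fT (graphConv net.B T w))
          = (iS (graphConv net.A S (x (t + 1))) - iT (graphConv net.A S (x (t + 1))))
            + iT (graphConv net.A S (x (t + 1)) - graphConv net.A T (x (t + 1)))
            + (fS (graphConv net.B S z) - fT (graphConv net.B S z))
            + fT (graphConv net.B S z - graphConv net.B T z)
            + fT (graphConv net.B T (z - w)) := by
        simp only [map_sub]; abel
      grw [norm_act_sub_le hσ, h1, norm_add_le, norm_add_le, norm_add_le, norm_add_le, hi, hf,
        hti, htf, htf, norm_graphConv_sub_le dA, norm_graphConv_sub_le dB,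
        norm_graphConv_apply_le hS hA, norm_graphConv_apply_le hS hB,
        norm_graphConv_apply_le hT hB, hx, ih, hz]
      have ht : (0 : ℝ) ≤ t := t.cast_nonneg
      -- The step adds at most `Δ (t+1) + q (t+1)`. The claimed cubic and quartic terms grow faster
      -- than the contribution of `q`; `e1` and `e2` are exactly the surplus.
      have e1 : 0 ≤ Q * η * (2 * t ^ 2 + t) := by positivity
      have e2 : 0 ≤ Q * φ₁ * Δ * ((3 * t ^ 3 + 5 * t ^ 2 + 2 * t) / 2) := by positivity
      rw [hq]
      push_cast
      linarith
  -- The output filter contributes another `Δ t`, turning `t(t+1)/2` into `(t² + 3t)/2`.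
  have h1 : graphConv net.C S (net.state S x t) - graphConv net.C T (net.state T x t)
      = (graphConv net.C S (net.state S x t) - graphConv net.C T (net.state S x t))
        + graphConv net.C T (net.state S x t - net.state T x t) := by
    simp only [map_sub]; abel
  grw [output, output, norm_act_sub_le hρ, h1, norm_add_le, norm_graphConv_sub_le dC,
    norm_graphConv_apply_le hT hC, hnorm, hdiff]
  apply le_of_eq; ring

end GatedGRNN

end Signals

/-! ### Assembly of the stability bound -/

theorem mainTheorem1 {n : ℕ} {Wi Wf : Type*} [NormedAddCommGroup Wi] [NormedAddCommGroup Wf]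
    (I : Set ℝ) (hI : I.OrdConnected)
    (net : GatedGRNN n Wi Wf)
    (S : Matrix (Fin n) (Fin n) ℝ) (hS : S ∈ shiftOperators n I)
    -- normalized integral Lipschitz filters
    (cA cB cC cAi cBi cAf cBf : ℝ)
    (hA : NormalizedFilterOn net.A I cA) (hB : NormalizedFilterOn net.B I cB)
    (hC : NormalizedFilterOn net.C I cC)
    (hAi : NormalizedFilterOn net.Ai I cAi) (hBi : NormalizedFilterOn net.Bi I cBi)
    (hAf : NormalizedFilterOn net.Af I cAf) (hBf : NormalizedFilterOn net.Bf I cBf)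
    (C : ℝ) (hCmax : C = max cA (max cB (max cAi (max cBi (max cAf (max cBf cC))))))
    -- normalized Lipschitz activation functions
    (hσ : NormalizedLipschitz net.σ) (hρ : NormalizedLipschitz net.ρ)
    (hσi : NormalizedLipschitz net.σi) (hσf : NormalizedLipschitz net.σf)
    -- gates
    (hGi : net.inputGate.Normalized I) (hGf : net.forgetGate.Normalized I)
    (Q φ₁ φ₂ : ℝ) (hQ : 0 ≤ Q) (hφ₁ : 0 ≤ φ₁) (hφ₂ : 0 ≤ φ₂)
    (hQi : net.inputGate.OpLipschitz Q) (hQf : net.forgetGate.OpLipschitz Q)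
    (hφi : net.inputGate.StateLipschitz I φ₁) (hφf : net.forgetGate.StateLipschitz I φ₁)
    -- Lipschitz dependence on the graph, in the relative distance (factor `κ = 1`) or in the
    -- norm distance of the shift operators (factor `κ = 2 ‖S‖`)
    (κ : ℝ)
    (hφG :
      (κ = 1 ∧ net.inputGate.RelGraphLipschitz I φ₂ ∧ net.forgetGate.RelGraphLipschitz I φ₂) ∨
      (κ = 2 * ‖S‖ ∧ net.inputGate.GraphLipschitz I φ₂ ∧ net.forgetGate.GraphLipschitz I φ₂))
    (t : ℕ) :
    ∃ K : ℝ, ∀ (ε : ℝ) (S' E : Matrix (Fin n) (Fin n) ℝ) (P : Equiv.Perm (Fin n))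
      (V U : Matrix (Fin n) (Fin n) ℂ) (l m : Fin n → ℂ) (x : ℕ → Signal n),
      S' ∈ shiftOperators n I →
      IsRelPerturbation S S' P E →
      IsUnitaryEigendecomp S V l →
      IsUnitaryEigendecomp E U m →
      graphDist S S' ≤ ‖E‖ → ‖E‖ ≤ ε →
      net.inputGate.EquivariantUnder I P → net.forgetGate.EquivariantUnder I P →
      (∀ s, ‖x s‖ ≤ 1) →
      (⨅ R : Equiv.Perm (Fin n),
          ‖net.output S x t
            - matOp (permMat R)ᵀ (net.output S' (fun s => matOp (permMat P) (x s)) t)‖)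
        ≤ C * (1 + misalignment U V * √(n : ℝ)) * (3 * t + t ^ 2) * ε
          + Q * (κ * φ₂ + φ₁ * C * (1 + misalignment U V * √(n : ℝ))) * t ^ 3 * ε
          + Q * φ₁ * C * (1 + misalignment U V * √(n : ℝ)) * t ^ 4 * ε
          + K * ε ^ 2 := by
  have hle : ∀ {h : ℝ[X]} {c : ℝ}, NormalizedFilterOn h I c → c ≤ C → NormalizedFilterOn h I C :=
    fun hh hc => ⟨⟨hh.1.1.trans hc, fun a ha b hb => (hh.1.2 a ha b hb).trans (by gcongr)⟩, hh.2⟩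
  have hmax : cA ≤ C ∧ cB ≤ C ∧ cC ≤ C ∧ cAi ≤ C ∧ cBi ≤ C ∧ cAf ≤ C ∧ cBf ≤ C := by
    simp [hCmax]
  obtain ⟨mA, mB, mC, mAi, mBi, mAf, mBf⟩ := hmax
  have hC0 : 0 ≤ C := hA.1.1.trans mA
  obtain ⟨K, hK, hfil⟩ : ∃ K, 0 ≤ K ∧ ∀ (S₁ E : Matrix (Fin n) (Fin n) ℝ)
      (V U : Matrix (Fin n) (Fin n) ℂ) (l m : Fin n → ℂ), S₁ ∈ shiftOperators n I →
      S₁ = S + (E * S + S * E) → IsUnitaryEigendecomp S V l → IsUnitaryEigendecomp E U m →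
      ∀ h ∈ [net.A, net.B, net.C, net.Ai, net.Bi, net.Af, net.Bf],
      ‖aeval S₁ h - aeval S h‖
        ≤ 2 * (C * (1 + misalignment U V * √(n : ℝ))) * ‖E‖ + K * ‖E‖ ^ 2 := by
    have hall : ∀ h ∈ [net.A, net.B, net.C, net.Ai, net.Bi, net.Af, net.Bf],
        NormalizedFilterOn h I C := by
      simp only [List.mem_cons, List.not_mem_nil, or_false, forall_eq_or_imp, forall_eq]
      exact ⟨hle hA mA, hle hB mB, hle hC mC, hle hAi mAi, hle hBi mBi, hle hAf mAf, hle hBf mBf⟩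
    generalize [net.A, net.B, net.C, net.Ai, net.Bi, net.Af, net.Bf] = L at hall
    induction L with
    | nil => exact ⟨0, le_rfl, by simp⟩
    | cons h L ih =>
      obtain ⟨K₁, hK₁, h₁⟩ := exists_norm_aeval_sub_le hI hS (hall h List.mem_cons_self)
      obtain ⟨K₂, hK₂, h₂⟩ := ih fun g hg => hall g (List.mem_cons_of_mem _ hg)
      refine ⟨K₁ + K₂, by positivity, fun S₁ E V U l m hS₁ hE hdS hdE g hg => ?_⟩
      have e₁ : 0 ≤ K₁ * ‖E‖ ^ 2 := by positivity
      have e₂ : 0 ≤ K₂ * ‖E‖ ^ 2 := by positivity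
      rcases List.mem_cons.1 hg with rfl | hg
      · linarith [h₁ S₁ E V U l m hS₁ hE hdS hdE]
      · linarith [h₂ S₁ E V U l m hS₁ hE hdS hdE g hg]
  -- The contribution of the quadratic part `K ε²` of the filter error `Δ` to the bound of
  -- `GatedGRNN.norm_output_sub_le`; it involves neither `E` nor `ε`.
  refine ⟨K * ((t ^ 2 + 3 * t) / 2) + Q * φ₁ * K * ((t ^ 3 + t ^ 4) / 2), ?_⟩
  intro ε S' E P V U l m x hS' hP hdS hdE _ hEε hEi hEf hx
  have hε : 0 ≤ ε := (norm_nonneg E).trans hEε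
  have hδ := misalignment_nonneg U V
  set S₁ := (permMat P)ᵀ * S' * permMat P with hS₁def
  have hS₁ : S₁ ∈ shiftOperators n I := permMat_conj_mem_shiftOperators hS' P
  have hS₁E : S₁ = S + (E * S + S * E) := hP
  have hS'S₁ : S' = permMat P * S₁ * (permMat P)ᵀ := by
    calc S' = 1 * S' * 1 := by simp
      _ = _ := by rw [← permMat_mul_transpose_self P, hS₁def]; noncomm_ring
  have hκ : 0 ≤ κ := by
    rcases hφG with ⟨rfl, -⟩ | ⟨rfl, -⟩ <;> positivity
  have hmodel : (∀ z, ‖net.inputGate.model S z - net.inputGate.model S₁ z‖ ≤ κ * φ₂ * ε * ‖z‖) ∧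
      ∀ z, ‖net.forgetGate.model S z - net.forgetGate.model S₁ z‖ ≤ κ * φ₂ * ε * ‖z‖ := by
    rcases hφG with ⟨rfl, hi, hf⟩ | ⟨rfl, hi, hf⟩
    · have hrel : IsRelPerturbation S S₁ 1 E := by
        simpa [IsRelPerturbation, permMat_one] using hS₁E
      refine ⟨fun z => ?_, fun z => ?_⟩
      · grw [hi S hS S₁ hS₁ E hrel z, hEε, one_mul]
      · grw [hf S hS S₁ hS₁ E hrel z, hEε, one_mul]
    -- The norm distance is `‖E S + S E‖`, whence `κ = 2‖S‖`.
    · have hn : ‖S - S₁‖ ≤ 2 * ‖S‖ * ε := by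
        rw [norm_sub_rev, hS₁E, add_sub_cancel_left]
        grw [norm_add_le, norm_mul_le, norm_mul_le, hEε]
        apply le_of_eq; ring
      refine ⟨fun z => ?_, fun z => ?_⟩
      · grw [hi S hS S₁ hS₁ z, hn]
        apply le_of_eq; ring
      · grw [hf S hS S₁ hS₁ z, hn]
        apply le_of_eq; ring
  set D := C * (1 + misalignment U V * √(n : ℝ)) with hD
  have hD0 : 0 ≤ D := by positivity
  have hΔ : ∀ h ∈ [net.A, net.B, net.C, net.Ai, net.Bi, net.Af, net.Bf],
      ‖aeval S₁ h - aeval S h‖ ≤ 2 * D * ε + K * ε ^ 2 := fun h hh => by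
    grw [hfil S₁ E V U l m hS₁ hS₁E hdS hdE h hh, hEε]
  have hout := net.norm_output_sub_le hA hB hC hAi hBi hAf hBf hσ hρ hσi hσf hGi hGf hQ hφ₁
    hQi hQf hφi hφf hS hS₁ hx (Δ := 2 * D * ε + K * ε ^ 2) (η := κ * φ₂ * ε)
    (by positivity) (by positivity) hΔ hmodel.1 hmodel.2 t
  -- The choice `R = P` undoes the relabelling and leaves the output on `S₁` with the original
  -- input.
  refine (ciInf_le ⟨0, by rintro _ ⟨R, rfl⟩; exact norm_nonneg _⟩ P).trans ?_
  rw [GatedGRNN.output_matOp_permMat hS₁ hS'S₁ hEi hEf, ← matOp_mul_apply,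
    permMat_transpose_mul_self, matOp_one_apply]
  refine hout.trans (le_of_eq ?_)
  rw [hD]
  ring
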